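/- **Setting (LF with refinements, LFR, canonical forms).** The grammar, up to renaming of bound variables, is: atomic terms $R ::= c \mid x \mid R\,N$ and normal terms $N ::= R \mid \lambda x.\,N$; types $P ::= a \mid P\,N$, $A ::= P \mid \Pi x{:}A_1.\,A_2$; sorts $Q ::= s \mid Q\,N$, $S,T ::= Q \mid \Pi x{::}S_1{\sqsubset}A_1.\,S_2 \mid \top \mid S_1\wedge S_2$; kinds $K ::= \mathsf{type} \mid \Pi x{:}A.\,K$; classes $L ::= \mathsf{sort} \mid \Pi x{::}S{\sqsubset}A.\,L \mid \top \mid L_1\wedge L_2$. A signature $\Sigma$ consists of declarations $a{:}K$, $c{:}A$, $s{\sqsubset}a{::}L$, $s_1\le s_2$, $c{::}S$, and a context $\Gamma$ of declarations $x{::}S{\sqsubset}A$; $\Sigma^*$ keeps only the declarations $a{:}K$, $c{:}A$ of $\Sigma$, and $\Gamma^*$ replaces each $x{::}S{\sqsubset}A$ by $x{:}A$. Types erase to simple types by $|a\,N_1\cdots N_n| = a$ and $|\Pi x{:}A.\,B| = |A|\to|B|$. The $\eta$-expansion is $\eta_a(R)=R$, $\eta_{\alpha\to\beta}(R)=\lambda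 x.\,\eta_\beta(R\;\eta_\alpha(x))$, and $\eta_A := \eta_{|A|}$. $[N/x]_A$ denotes hereditary substitution (substitution that contracts, at the simple type $|A|$, the redexes it creates), a partial operation. Atomic subsorting $Q\le Q'$ is the reflexive-transitive closure of $s_1\,N_1\cdots N_n\le s_2\,N_1\cdots N_n$ for $s_1\le s_2\in\Sigma$. Sort synthesis $\Gamma\vdash R\Rightarrow S$ and sort checking $\Gamma\vdash N\Leftarrow S$ are defined by: $\Gamma\vdash c\Rightarrow S$ if $c{::}S\in\Sigma$; $\Gamma\vdash x\Rightarrow S$ if $x{::}S{\sqsubset}A\in\Gamma$; if $\Gamma\vdash R\Rightarrow\Pi x{::}S{\sqsubset}A.\,T$, $\Gamma\vdash N\Leftarrow S$ and $[N/x]_A T=T'$, then $\Gamma\vdash R\,N\Rightarrow T'$; if $\Gamma\vdash R\Rightarrow S_1\wedge S_2$, then $\Gamma\vdash R\Rightarrow S_i$ for $i=1,2$; if $\Gamma\vdash R\Rightarrow Q'$ and $Q'\le Q$, then $\Gamma\vdash R\Leftarrow Q$; if $\Gamma,x{::}S{\sqsubset}A\vdash N\Leftarrow T$, then $\Gamma\vdash\lambda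 x.N\Leftarrow\Pi x{::}S{\sqsubset}A.\,T$; $\Gamma\vdash N\Leftarrow\top$ always; if $\Gamma\vdash N\Leftarrow S_1$ and $\Gamma\vdash N\Leftarrow S_2$, then $\Gamma\vdash N\Leftarrow S_1\wedge S_2$. Sort formation is defined by: $\Gamma\vdash s\sqsubset a\Rightarrow L$ if $s{\sqsubset}a{::}L\in\Sigma$; if $\Gamma\vdash Q\sqsubset P\Rightarrow\Pi x{::}S{\sqsubset}A.\,L$, $\Gamma\vdash N\Leftarrow S$ and $[N/x]_A L=L'$, then $\Gamma\vdash Q\,N\sqsubset P\,N\Rightarrow L'$; if $\Gamma\vdash Q\sqsubset P\Rightarrow L_1\wedge L_2$, then $\Gamma\vdash Q\sqsubset P\Rightarrow L_i$; if $\Gamma\vdash Q\sqsubset P\Rightarrow\mathsf{sort}$, then $\Gamma\vdash Q\sqsubset P$; if $\Gamma\vdash S\sqsubset A$ and $\Gamma,x{::}S{\sqsubset}A\vdash T\sqsubset B$, then $\Gamma\vdash\Pi x{::}S{\sqsubset}A.\,T\sqsubset\Pi x{:}A.\,B$; $\Gamma\vdash\top\sqsubset A$; if $\Gamma\vdash S_1\sqsubset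 A$ and $\Gamma\vdash S_2\sqsubset A$, then $\Gamma\vdash S_1\wedge S_2\sqsubset A$. Refinement of kinds by classes, $\Gamma\vdash L\sqsubset K$, is defined likewise from $\mathsf{sort}\sqsubset\mathsf{type}$. LF judgments, such as $\Gamma^*\vdash A\Leftarrow\mathsf{type}$, are those of canonical LF over $\Sigma^*$. A context is well-formed if each $x{::}S{\sqsubset}A$ in it satisfies $S\sqsubset A$ in the context before it. A signature is well-formed if, over the signature before it, each $a{:}K$ and $c{:}A$ has $K$ a kind and $A$ a type of LF over the erased signature, each $s{\sqsubset}a{::}L$ has $a{:}K$ declared with $L\sqsubset K$, each $c{::}S$ has $c{:}A$ declared with $S\sqsubset A$, each $s_1\le s_2$ has $s_1{\sqsubset}a{::}L$ and $s_2{\sqsubset}a{::}L$ declared for the same $a$ and $L$, and no constant receives two declarations of the same one of the forms $a{:}K$, $c{:}A$, $s{\sqsubset}a{::}L$, $c{::}S$. *Declarative subsorting* $\Gamma\vdash S\le T\sqsubset A$ is the least relation that contains atomic subsorting ($\Gamma\vdash Q\le Q'\sqsubset P$ whenever $Q\le Q'$) and is closed under the rules (with $\Gamma$ and $A$ fixed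 where not shown, and $\Pi x{::}S.\,T$ short for $\Pi x{::}S{\sqsubset}A.\,T$ in judgments at $\Pi x{:}A.\,A'$): - reflexivity $S\le S$ and transitivity; - if $\Gamma\vdash S_2\le S_1\sqsubset A$ and $\Gamma,x{::}S_2{\sqsubset}A\vdash T_1\le T_2\sqsubset A'$, then $\Gamma\vdash \Pi x{::}S_1.\,T_1\le\Pi x{::}S_2.\,T_2\sqsubset\Pi x{:}A.\,A'$; - $S\le\top$; if $T\le S_1$ and $T\le S_2$, then $T\le S_1\wedge S_2$; if $S_1\le T$ or $S_2\le T$, then $S_1\wedge S_2\le T$; - $\top\le\Pi x{::}S.\,\top$ and $(\Pi x{::}S.\,T_1)\wedge(\Pi x{::}S.\,T_2)\le\Pi x{::}S.\,(T_1\wedge T_2)$, both at $\Pi x{:}A.\,A'$. **Theorem (Soundness of Declarative Subsorting).** Let $\Sigma$ be a well-formed signature, $\Gamma$ a well-formed context whose erasure $\Gamma^*$ is a well-formed LF context, $A$ a type with $\Gamma^*\vdash A\Leftarrow\mathsf{type}$, and $S,T$ sorts with $\Gamma\vdash S\sqsubset A$ and $\Gamma\vdash T\sqsubset A$. If $\Gamma\vdash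 S\le T\sqsubset A$ is derivable, then $$\Gamma,\,x{::}S{\sqsubset}A\;\vdash\;\eta_A(x)\Leftarrow T .$$ -/

import Mathlib

/-! LF with refinements (LFR), in the canonical-forms style.

Terms are represented up to renaming of bound variables by de Bruijn indices.  Contexts are lists
whose head is the most recent declaration; the classifiers of an entry live in the tail of the
list after that entry. Names of constants are natural numbers, with one name space each for type
family constants `a`, sort family constants `s` and term constants `c`. -/

namespace LFR

/-! ### Grammar -/

mutual
/-- Atomic terms `R ::= c | x | R N`. -/
inductive Atm : Type
  | const (c : ℕ) : Atm
  | var (i : ℕ) : Atm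
  | app (R : Atm) (N : Nrm) : Atm
/-- Normal terms `N ::= R | λx. N`. -/
inductive Nrm : Type
  | atom (R : Atm) : Nrm
  | lam (N : Nrm) : Nrm
end

/-- Atomic type families `P ::= a | P N`. -/
inductive ATy : Type
  | const (a : ℕ) : ATy
  | app (P : ATy) (N : Nrm) : ATy

/-- Normal type families `A ::= P | Πx:A₁. A₂`. -/
inductive Ty : Type
  | atom (P : ATy) : Ty
  | pi (A B : Ty) : Ty

/-- Atomic sort families `Q ::= s | Q N`. -/
inductive ASrt : Type
  | const (s : ℕ) : ASrt
  | app (Q : ASrt) (N : Nrm) : ASrt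

/-- Normal sort families `S ::= Q | Πx::S₁⊏A₁. S₂ | ⊤ | S₁ ∧ S₂`. -/
inductive Srt : Type
  | atom (Q : ASrt) : Srt
  | pi (S : Srt) (A : Ty) (T : Srt) : Srt
  | top : Srt
  | inter (S T : Srt) : Srt

/-- Kinds `K ::= type | Πx:A. K`. -/
inductive Knd : Type
  | type : Knd
  | pi (A : Ty) (K : Knd) : Knd

/-- Classes `L ::= sort | Πx::S⊏A. L | ⊤ | L₁ ∧ L₂`. -/
inductive Cls : Type
  | sort : Cls
  | pi (S : Srt) (A : Ty) (L : Cls) : Cls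
  | top : Cls
  | inter (L₁ L₂ : Cls) : Cls

/-- Declarations `D ::= a:K | c:A | s⊏a::L | s₁≤s₂ | c::S`. -/
inductive Decl : Type
  | tyDecl (a : ℕ) (K : Knd) : Decl
  | tmDecl (c : ℕ) (A : Ty) : Decl
  | srtRef (s a : ℕ) (L : Cls) : Decl
  | subDecl (s₁ s₂ : ℕ) : Decl
  | tmRef (c : ℕ) (S : Srt) : Decl

/-- Signatures, most recent declaration first. -/
abbrev Sig := List Decl

/-- LFR contexts: an entry `(S, A)` is a declaration `x::S⊏A`. -/
abbrev Ctx := List (Srt × Ty)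

/-- LF contexts: an entry `A` is a declaration `x:A`. -/
abbrev LFCtx := List Ty

/-- Whether a declaration is one of pure LF. -/
def Decl.isLF : Decl → Bool
  | .tyDecl _ _ => true
  | .tmDecl _ _ => true
  | _ => false

/-- Erasure of the refinement declarations from a signature. -/
def Sig.erase (Sg : Sig) : Sig := Sg.filter Decl.isLF

/-- Erasure of an LFR context to an LF context. -/
def Ctx.erase (Γ : Ctx) : LFCtx := Γ.map Prod.snd

/-! ### Weakening: `shift k` makes room for a new variable at index `k` -/

mutual
def Atm.shift (k : ℕ) : Atm → Atm
  | .const c => .const c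
  | .var i => .var (if i < k then i else i + 1)
  | .app R N => .app (R.shift k) (N.shift k)
def Nrm.shift (k : ℕ) : Nrm → Nrm
  | .atom R => .atom (R.shift k)
  | .lam N => .lam (N.shift (k + 1))
end

def ATy.shift (k : ℕ) : ATy → ATy
  | .const a => .const a
  | .app P N => .app (P.shift k) (N.shift k)

def Ty.shift (k : ℕ) : Ty → Ty
  | .atom P => .atom (P.shift k)
  | .pi A B => .pi (A.shift k) (B.shift (k + 1))

def ASrt.shift (k : ℕ) : ASrt → ASrt
  | .const s => .const s
  | .app Q N => .app (Q.shift k) (N.shift k)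

def Srt.shift (k : ℕ) : Srt → Srt
  | .atom Q => .atom (Q.shift k)
  | .pi S A T => .pi (S.shift k) (A.shift k) (T.shift (k + 1))
  | .top => .top
  | .inter S T => .inter (S.shift k) (T.shift k)

/-! ### Simple types, erasure of dependencies, η-expansion -/

/-- Simple types `α ::= a | α₁ → α₂`. -/
inductive STy : Type
  | base (a : ℕ) : STy
  | arr (α β : STy) : STy

/-- The head constant of an atomic type family. -/
def ATy.head : ATy → ℕ
  | .const a => a
  | .app P _ => P.head

/-- Erasure of a type family to a simple type. -/
def Ty.erase : Ty → STy
  | .atom P => .base P.head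
  | .pi A B => .arr A.erase B.erase

/-- η-expansion of an atomic term at a simple type:
`η_a(R) = R` and `η_{α→β}(R) = λx. η_β(R η_α(x))`. -/
def expand : STy → Atm → Nrm
  | .base _, R => .atom R
  | .arr α β, R => .lam (expand β (.app (R.shift 0) (expand α (.var 0))))

/-! ### Hereditary substitution

`SubN N₀ k α₀ N Nᵣ` says that the hereditary substitution `[N₀/x₀]_{α₀} N` is defined and equals
`Nᵣ`, where `x₀` is the variable with index `k` in `N`.  Variable `k` is removed, so variables
beyond it are renumbered; `N₀` and the result live in the context without `x₀`. -/

mutual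
/-- Substitution into normal terms. -/
inductive SubN : Nrm → ℕ → STy → Nrm → Nrm → Prop
  | atom {N₀ k α₀ R Rᵣ} : SubRR N₀ k α₀ R Rᵣ → SubN N₀ k α₀ (.atom R) (.atom Rᵣ)
  | atomNorm {N₀ k α₀ R Rᵣ a} :
      SubRN N₀ k α₀ R (.atom Rᵣ) (.base a) → SubN N₀ k α₀ (.atom R) (.atom Rᵣ)
  | lam {N₀ k α₀ N Nᵣ} :
      SubN (N₀.shift 0) (k + 1) α₀ N Nᵣ → SubN N₀ k α₀ (.lam N) (.lam Nᵣ)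
/-- Substitution into atomic terms whose head is not `x₀`, yielding an atomic term. -/
inductive SubRR : Nrm → ℕ → STy → Atm → Atm → Prop
  | varLt {N₀ k α₀ i} : i < k → SubRR N₀ k α₀ (.var i) (.var i)
  | varGt {N₀ k α₀ i} : k ≤ i → SubRR N₀ k α₀ (.var (i + 1)) (.var i)
  | const {N₀ k α₀ c} : SubRR N₀ k α₀ (.const c) (.const c)
  | app {N₀ k α₀ R Rᵣ N Nᵣ} : SubRR N₀ k α₀ R Rᵣ → SubN N₀ k α₀ N Nᵣ →
      SubRR N₀ k α₀ (.app R N) (.app Rᵣ Nᵣ)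
/-- Substitution into atomic terms whose head is `x₀`, yielding a normal term and a simple type. -/
inductive SubRN : Nrm → ℕ → STy → Atm → Nrm → STy → Prop
  | var {N₀ k α₀} : SubRN N₀ k α₀ (.var k) N₀ α₀
  | beta {N₀ k α₀ R₁ N₁ N₁ᵣ N₂ N₂ᵣ α₁ α₂} :
      SubRN N₀ k α₀ R₁ (.lam N₁) (.arr α₂ α₁) → SubN N₀ k α₀ N₂ N₂ᵣ →
      SubN N₂ᵣ 0 α₂ N₁ N₁ᵣ → SubRN N₀ k α₀ (.app R₁ N₂) N₁ᵣ α₁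
end

/-- Substitution into atomic types. -/
inductive SubP : Nrm → ℕ → STy → ATy → ATy → Prop
  | const {N₀ k α₀ a} : SubP N₀ k α₀ (.const a) (.const a)
  | app {N₀ k α₀ P Pᵣ N Nᵣ} : SubP N₀ k α₀ P Pᵣ → SubN N₀ k α₀ N Nᵣ →
      SubP N₀ k α₀ (.app P N) (.app Pᵣ Nᵣ)

/-- Substitution into types. -/
inductive SubA : Nrm → ℕ → STy → Ty → Ty → Prop
  | atom {N₀ k α₀ P Pᵣ} : SubP N₀ k α₀ P Pᵣ → SubA N₀ k α₀ (.atom P) (.atom Pᵣ)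
  | pi {N₀ k α₀ A Aᵣ B Bᵣ} : SubA N₀ k α₀ A Aᵣ → SubA (N₀.shift 0) (k + 1) α₀ B Bᵣ →
      SubA N₀ k α₀ (.pi A B) (.pi Aᵣ Bᵣ)

/-- Substitution into atomic sorts. -/
inductive SubQ : Nrm → ℕ → STy → ASrt → ASrt → Prop
  | const {N₀ k α₀ s} : SubQ N₀ k α₀ (.const s) (.const s)
  | app {N₀ k α₀ Q Qᵣ N Nᵣ} : SubQ N₀ k α₀ Q Qᵣ → SubN N₀ k α₀ N Nᵣ →
      SubQ N₀ k α₀ (.app Q N) (.app Qᵣ Nᵣ)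

/-- Substitution into sorts. -/
inductive SubS : Nrm → ℕ → STy → Srt → Srt → Prop
  | atom {N₀ k α₀ Q Qᵣ} : SubQ N₀ k α₀ Q Qᵣ → SubS N₀ k α₀ (.atom Q) (.atom Qᵣ)
  | pi {N₀ k α₀ S Sᵣ A Aᵣ T Tᵣ} : SubS N₀ k α₀ S Sᵣ → SubA N₀ k α₀ A Aᵣ →
      SubS (N₀.shift 0) (k + 1) α₀ T Tᵣ → SubS N₀ k α₀ (.pi S A T) (.pi Sᵣ Aᵣ Tᵣ)
  | top {N₀ k α₀} : SubS N₀ k α₀ .top .top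
  | inter {N₀ k α₀ S Sᵣ T Tᵣ} : SubS N₀ k α₀ S Sᵣ → SubS N₀ k α₀ T Tᵣ →
      SubS N₀ k α₀ (.inter S T) (.inter Sᵣ Tᵣ)

/-- Substitution into kinds. -/
inductive SubK : Nrm → ℕ → STy → Knd → Knd → Prop
  | type {N₀ k α₀} : SubK N₀ k α₀ .type .type
  | pi {N₀ k α₀ A Aᵣ K Kᵣ} : SubA N₀ k α₀ A Aᵣ → SubK (N₀.shift 0) (k + 1) α₀ K Kᵣ →
      SubK N₀ k α₀ (.pi A K) (.pi Aᵣ Kᵣ)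

/-- Substitution into classes. -/
inductive SubL : Nrm → ℕ → STy → Cls → Cls → Prop
  | sort {N₀ k α₀} : SubL N₀ k α₀ .sort .sort
  | pi {N₀ k α₀ S Sᵣ A Aᵣ L Lᵣ} : SubS N₀ k α₀ S Sᵣ → SubA N₀ k α₀ A Aᵣ →
      SubL (N₀.shift 0) (k + 1) α₀ L Lᵣ → SubL N₀ k α₀ (.pi S A L) (.pi Sᵣ Aᵣ Lᵣ)
  | top {N₀ k α₀} : SubL N₀ k α₀ .top .top
  | inter {N₀ k α₀ L₁ L₁ᵣ L₂ L₂ᵣ} : SubL N₀ k α₀ L₁ L₁ᵣ → SubL N₀ k α₀ L₂ L₂ᵣ →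
      SubL N₀ k α₀ (.inter L₁ L₂) (.inter L₁ᵣ L₂ᵣ)

/-! ### Canonical LF -/

/-- `x:A ∈ Γ`, with `A` weakened to the whole context. -/
inductive LFLookup : LFCtx → ℕ → Ty → Prop
  | here {Γ A} : LFLookup (A :: Γ) 0 (A.shift 0)
  | there {Γ i A B} : LFLookup Γ i A → LFLookup (B :: Γ) (i + 1) (A.shift 0)

mutual
/-- `Γ ⊢ R ⇒ A` in LF. -/
inductive LFSynth (Sg : Sig) : LFCtx → Atm → Ty → Prop
  | const {Γ c A} : Decl.tmDecl c A ∈ Sg → LFSynth Sg Γ (.const c) A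
  | var {Γ i A} : LFLookup Γ i A → LFSynth Sg Γ (.var i) A
  | app {Γ R N A B Bᵣ} : LFSynth Sg Γ R (.pi A B) → LFCheck Sg Γ N A →
      SubA N 0 A.erase B Bᵣ → LFSynth Sg Γ (.app R N) Bᵣ
/-- `Γ ⊢ N ⇐ A` in LF. -/
inductive LFCheck (Sg : Sig) : LFCtx → Nrm → Ty → Prop
  | atom {Γ R P} : LFSynth Sg Γ R (.atom P) → LFCheck Sg Γ (.atom R) (.atom P)
  | lam {Γ N A B} : LFCheck Sg (A :: Γ) N B → LFCheck Sg Γ (.lam N) (.pi A B)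
end

/-- `Γ ⊢ P ⇒ K` in LF. -/
inductive LFSynthKind (Sg : Sig) : LFCtx → ATy → Knd → Prop
  | const {Γ a K} : Decl.tyDecl a K ∈ Sg → LFSynthKind Sg Γ (.const a) K
  | app {Γ P N A K Kᵣ} : LFSynthKind Sg Γ P (.pi A K) → LFCheck Sg Γ N A →
      SubK N 0 A.erase K Kᵣ → LFSynthKind Sg Γ (.app P N) Kᵣ

/-- `Γ ⊢ A ⇐ type` in LF. -/
inductive LFType (Sg : Sig) : LFCtx → Ty → Prop
  | atom {Γ P} : LFSynthKind Sg Γ P .type → LFType Sg Γ (.atom P)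
  | pi {Γ A B} : LFType Sg Γ A → LFType Sg (A :: Γ) B → LFType Sg Γ (.pi A B)

/-- `Γ ⊢ K ⇐ kind` in LF. -/
inductive LFKind (Sg : Sig) : LFCtx → Knd → Prop
  | type {Γ} : LFKind Sg Γ .type
  | pi {Γ A K} : LFType Sg Γ A → LFKind Sg (A :: Γ) K → LFKind Sg Γ (.pi A K)

/-- `⊢ Γ ctx` in LF. -/
inductive LFCtxWf (Sg : Sig) : LFCtx → Prop
  | nil : LFCtxWf Sg []
  | cons {Γ A} : LFCtxWf Sg Γ → LFType Sg Γ A → LFCtxWf Sg (A :: Γ)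

/-! ### Sort checking -/

/-- `x::S⊏A ∈ Γ`, with `S` and `A` weakened to the whole context. -/
inductive Lookup : Ctx → ℕ → Srt → Ty → Prop
  | here {Γ S A} : Lookup ((S, A) :: Γ) 0 (S.shift 0) (A.shift 0)
  | there {Γ i S A e} : Lookup Γ i S A → Lookup (e :: Γ) (i + 1) (S.shift 0) (A.shift 0)

/-- One declared subsorting step between atomic sorts: `s₁ N₁ … Nₙ ≤ s₂ N₁ … Nₙ` for a
declaration `s₁ ≤ s₂` of the signature. -/
inductive SubStep (Sg : Sig) : ASrt → ASrt → Prop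
  | decl {s₁ s₂} : Decl.subDecl s₁ s₂ ∈ Sg → SubStep Sg (.const s₁) (.const s₂)
  | app {Q₁ Q₂ N} : SubStep Sg Q₁ Q₂ → SubStep Sg (.app Q₁ N) (.app Q₂ N)

/-- Subsorting `Q₁ ≤ Q₂` on atomic sorts. -/
inductive AtomSub (Sg : Sig) : ASrt → ASrt → Prop
  | refl {Q} : AtomSub Sg Q Q
  | step {Q₁ Q Q₂} : SubStep Sg Q₁ Q → AtomSub Sg Q Q₂ → AtomSub Sg Q₁ Q₂

mutual
/-- `Γ ⊢ R ⇒ S`. -/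
inductive Synth (Sg : Sig) : Ctx → Atm → Srt → Prop
  | const {Γ c S} : Decl.tmRef c S ∈ Sg → Synth Sg Γ (.const c) S
  | var {Γ i S A} : Lookup Γ i S A → Synth Sg Γ (.var i) S
  | app {Γ R N S A T Tᵣ} : Synth Sg Γ R (.pi S A T) → Check Sg Γ N S →
      SubS N 0 A.erase T Tᵣ → Synth Sg Γ (.app R N) Tᵣ
  | interE₁ {Γ R S₁ S₂} : Synth Sg Γ R (.inter S₁ S₂) → Synth Sg Γ R S₁
  | interE₂ {Γ R S₁ S₂} : Synth Sg Γ R (.inter S₁ S₂) → Synth Sg Γ R S₂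
/-- `Γ ⊢ N ⇐ S`. -/
inductive Check (Sg : Sig) : Ctx → Nrm → Srt → Prop
  | switch {Γ R Q₀ Q} : Synth Sg Γ R (.atom Q₀) → AtomSub Sg Q₀ Q →
      Check Sg Γ (.atom R) (.atom Q)
  | lam {Γ N S A T} : Check Sg ((S, A) :: Γ) N T → Check Sg Γ (.lam N) (.pi S A T)
  | top {Γ N} : Check Sg Γ N .top
  | inter {Γ N S₁ S₂} : Check Sg Γ N S₁ → Check Sg Γ N S₂ → Check Sg Γ N (.inter S₁ S₂)
end

/-! ### Formation of sorts, classes, contexts and signatures -/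

/-- `Γ ⊢ Q ⊏ P ⇒ L`. -/
inductive SynthClass (Sg : Sig) : Ctx → ASrt → ATy → Cls → Prop
  | const {Γ s a L} : Decl.srtRef s a L ∈ Sg → SynthClass Sg Γ (.const s) (.const a) L
  | app {Γ Q P N S A L Lᵣ} : SynthClass Sg Γ Q P (.pi S A L) → Check Sg Γ N S →
      SubL N 0 A.erase L Lᵣ → SynthClass Sg Γ (.app Q N) (.app P N) Lᵣ
  | interE₁ {Γ Q P L₁ L₂} : SynthClass Sg Γ Q P (.inter L₁ L₂) → SynthClass Sg Γ Q P L₁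
  | interE₂ {Γ Q P L₁ L₂} : SynthClass Sg Γ Q P (.inter L₁ L₂) → SynthClass Sg Γ Q P L₂

/-- `Γ ⊢ S ⊏ A`. -/
inductive Refines (Sg : Sig) : Ctx → Srt → Ty → Prop
  | atom {Γ Q P} : SynthClass Sg Γ Q P .sort → Refines Sg Γ (.atom Q) (.atom P)
  | pi {Γ S A T B} : Refines Sg Γ S A → Refines Sg ((S, A) :: Γ) T B →
      Refines Sg Γ (.pi S A T) (.pi A B)
  | top {Γ A} : Refines Sg Γ .top A
  | inter {Γ S₁ S₂ A} : Refines Sg Γ S₁ A → Refines Sg Γ S₂ A → Refines Sg Γ (.inter S₁ S₂) A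

/-- `Γ ⊢ L ⊏ K`. -/
inductive ClassRefines (Sg : Sig) : Ctx → Cls → Knd → Prop
  | sort {Γ} : ClassRefines Sg Γ .sort .type
  | pi {Γ S A L K} : Refines Sg Γ S A → ClassRefines Sg ((S, A) :: Γ) L K →
      ClassRefines Sg Γ (.pi S A L) (.pi A K)
  | top {Γ K} : ClassRefines Sg Γ .top K
  | inter {Γ L₁ L₂ K} : ClassRefines Sg Γ L₁ K → ClassRefines Sg Γ L₂ K →
      ClassRefines Sg Γ (.inter L₁ L₂) K

/-- `⊢ Γ ctx`. -/
inductive CtxWf (Sg : Sig) : Ctx → Prop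
  | nil : CtxWf Sg []
  | cons {Γ S A} : CtxWf Sg Γ → Refines Sg Γ S A → CtxWf Sg ((S, A) :: Γ)

/-- `⊢ Σ sig`. -/
inductive SigWf : Sig → Prop
  | nil : SigWf []
  | tyDecl {Sg a K} : SigWf Sg → LFKind (Sig.erase Sg) [] K →
      (∀ K₀, Decl.tyDecl a K₀ ∉ Sg) → SigWf (.tyDecl a K :: Sg)
  | tmDecl {Sg c A} : SigWf Sg → LFType (Sig.erase Sg) [] A →
      (∀ A₀, Decl.tmDecl c A₀ ∉ Sg) → SigWf (.tmDecl c A :: Sg)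
  | srtRef {Sg s a L K} : SigWf Sg → Decl.tyDecl a K ∈ Sg → ClassRefines Sg [] L K →
      (∀ a₀ L₀, Decl.srtRef s a₀ L₀ ∉ Sg) → SigWf (.srtRef s a L :: Sg)
  | tmRef {Sg c S A} : SigWf Sg → Decl.tmDecl c A ∈ Sg → Refines Sg [] S A →
      (∀ S₀, Decl.tmRef c S₀ ∉ Sg) → SigWf (.tmRef c S :: Sg)
  | subDecl {Sg s₁ s₂ a L} : SigWf Sg → Decl.srtRef s₁ a L ∈ Sg → Decl.srtRef s₂ a L ∈ Sg →
      SigWf (.subDecl s₁ s₂ :: Sg)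

/-! ### Declarative subsorting at higher sorts -/

/-- `Γ ⊢ S₁ ≤ S₂ ⊏ A`: the usual rules for subsorting at arbitrary sorts, extending the
subsorting relation on atomic sorts (rule `atom`).  No rule demands that the sorts it
mentions be well-formed. -/
inductive DeclSub (Sg : Sig) : Ctx → Srt → Srt → Ty → Prop
  | atom {Γ Q₁ Q₂ P} : AtomSub Sg Q₁ Q₂ → DeclSub Sg Γ (.atom Q₁) (.atom Q₂) (.atom P)
  | refl {Γ S A} : DeclSub Sg Γ S S A
  | trans {Γ S₁ S₂ S₃ A} : DeclSub Sg Γ S₁ S₂ A → DeclSub Sg Γ S₂ S₃ A → DeclSub Sg Γ S₁ S₃ A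
  | pi {Γ S₁ S₂ T₁ T₂ A B} : DeclSub Sg Γ S₂ S₁ A → DeclSub Sg ((S₂, A) :: Γ) T₁ T₂ B →
      DeclSub Sg Γ (.pi S₁ A T₁) (.pi S₂ A T₂) (.pi A B)
  | topR {Γ S A} : DeclSub Sg Γ S .top A
  | interR {Γ T S₁ S₂ A} : DeclSub Sg Γ T S₁ A → DeclSub Sg Γ T S₂ A →
      DeclSub Sg Γ T (.inter S₁ S₂) A
  | interL₁ {Γ S₁ S₂ T A} : DeclSub Sg Γ S₁ T A → DeclSub Sg Γ (.inter S₁ S₂) T A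
  | interL₂ {Γ S₁ S₂ T A} : DeclSub Sg Γ S₂ T A → DeclSub Sg Γ (.inter S₁ S₂) T A
  | topPi {Γ S A B} : DeclSub Sg Γ .top (.pi S A .top) (.pi A B)
  | interPi {Γ S T₁ T₂ A B} :
      DeclSub Sg Γ (.inter (.pi S A T₁) (.pi S A T₂)) (.pi S A (.inter T₁ T₂)) (.pi A B)

end LFR

-- Sorts are interpreted by a Kripke logical relation `Sem` on atomic terms, in which a function is
-- tested only on η-expanded variables. Every declarative rule, distributivity included, is an
-- inclusion of interpretations (`DeclSub.sem`). Because `Sem` is defined on raw sorts, transitivity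
-- may pass through ill-formed ones.
--
-- Syntax and interpretation are linked at the two endpoints by `SrtTyped.reflect_reify`: an atomic
-- term that synthesizes a sort lies in its interpretation, and the η-expansion of a term in the
-- interpretation checks against the sort. The declared variable `x::S` thus lies in `S`, hence in
-- `T`, and its expansion checks against `T`.
--
-- Reflection at a Π applies a term to an expanded variable, and the application rule then
-- substitutes that expansion hereditarily into the codomain. The technical core,
-- `SrtTyped.sub_expand`, is that this substitution is defined and is merely a renaming, so no
-- general substitution theorem is needed. It rests on the index terms being η-long and simply
-- typed. LF typing of `A` provides this, and `S` and `T` inherit it because they refine `A`.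

namespace LFR

/-! ### Renaming -/

/-- The renaming that skips the index `k`. -/
def skip (k i : ℕ) : ℕ := if i < k then i else i + 1

/-- Extension of a renaming by a value for the most recent variable. -/
def scons (y : ℕ) (ρ : ℕ → ℕ) : ℕ → ℕ
  | 0 => y
  | i + 1 => ρ i

/-- The lifting of a renaming under a binder. -/
def up (ρ : ℕ → ℕ) : ℕ → ℕ := scons 0 (fun i => ρ i + 1)

@[simp] theorem up_zero (ρ : ℕ → ℕ) : up ρ 0 = 0 := rfl
@[simp] theorem up_succ (ρ : ℕ → ℕ) (i : ℕ) : up ρ (i + 1) = ρ i + 1 := rfl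

theorem skip_zero : skip 0 = Nat.succ := by
  funext i; simp [skip]

theorem scons_zero_skip (ρ : ℕ → ℕ) : scons 0 (skip 0 ∘ ρ) = up ρ := by
  rw [skip_zero]; rfl

theorem up_skip (k : ℕ) : up (skip k) = skip (k + 1) := by
  funext i
  cases i with
  | zero => simp [skip]
  | succ i => simp only [up_succ, skip]; split_ifs <;> omega

theorem up_comp (ρ τ : ℕ → ℕ) : up (ρ ∘ τ) = up ρ ∘ up τ := by
  funext i; cases i <;> rfl

mutual
def Atm.ren (ρ : ℕ → ℕ) : Atm → Atm
  | .const c => .const c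
  | .var i => .var (ρ i)
  | .app R N => .app (R.ren ρ) (N.ren ρ)
def Nrm.ren (ρ : ℕ → ℕ) : Nrm → Nrm
  | .atom R => .atom (R.ren ρ)
  | .lam N => .lam (N.ren (up ρ))
end

def ATy.ren (ρ : ℕ → ℕ) : ATy → ATy
  | .const a => .const a
  | .app P N => .app (P.ren ρ) (N.ren ρ)

def Ty.ren (ρ : ℕ → ℕ) : Ty → Ty
  | .atom P => .atom (P.ren ρ)
  | .pi A B => .pi (A.ren ρ) (B.ren (up ρ))

def ASrt.ren (ρ : ℕ → ℕ) : ASrt → ASrt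
  | .const s => .const s
  | .app Q N => .app (Q.ren ρ) (N.ren ρ)

def Srt.ren (ρ : ℕ → ℕ) : Srt → Srt
  | .atom Q => .atom (Q.ren ρ)
  | .pi S A T => .pi (S.ren ρ) (A.ren ρ) (T.ren (up ρ))
  | .top => .top
  | .inter S T => .inter (S.ren ρ) (T.ren ρ)

/-! Weakening is renaming. -/

mutual
theorem Atm.shift_eq_ren (k : ℕ) : ∀ R : Atm, R.shift k = R.ren (skip k)
  | .const c => rfl
  | .var i => rfl
  | .app R N => by simp only [Atm.shift, Atm.ren, Atm.shift_eq_ren k R, Nrm.shift_eq_ren k N]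
theorem Nrm.shift_eq_ren (k : ℕ) : ∀ N : Nrm, N.shift k = N.ren (skip k)
  | .atom R => by simp only [Nrm.shift, Nrm.ren, Atm.shift_eq_ren k R]
  | .lam N => by simp only [Nrm.shift, Nrm.ren, up_skip, Nrm.shift_eq_ren (k + 1) N]
end

theorem ATy.shift_eq_ren (k : ℕ) (P : ATy) : P.shift k = P.ren (skip k) := by
  induction P with
  | const a => rfl
  | app P N ih => simp only [ATy.shift, ATy.ren, ih, Nrm.shift_eq_ren]

theorem Ty.shift_eq_ren (k : ℕ) (A : Ty) : A.shift k = A.ren (skip k) := by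
  induction A generalizing k with
  | atom P => simp only [Ty.shift, Ty.ren, ATy.shift_eq_ren]
  | pi A B ihA ihB => simp only [Ty.shift, Ty.ren, ihA, ihB, up_skip]

theorem ASrt.shift_eq_ren (k : ℕ) (Q : ASrt) : Q.shift k = Q.ren (skip k) := by
  induction Q with
  | const s => rfl
  | app Q N ih => simp only [ASrt.shift, ASrt.ren, ih, Nrm.shift_eq_ren]

theorem Srt.shift_eq_ren (k : ℕ) (S : Srt) : S.shift k = S.ren (skip k) := by
  induction S generalizing k with
  | atom Q => simp only [Srt.shift, Srt.ren, ASrt.shift_eq_ren]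
  | pi S A T ihS ihT => simp only [Srt.shift, Srt.ren, ihS, ihT, Ty.shift_eq_ren, up_skip]
  | top => rfl
  | inter S T ihS ihT => simp only [Srt.shift, Srt.ren, ihS, ihT]

/-! Renamings compose. -/

mutual
theorem Atm.ren_ren (ρ τ : ℕ → ℕ) : ∀ R : Atm, (R.ren τ).ren ρ = R.ren (ρ ∘ τ)
  | .const c => rfl
  | .var i => rfl
  | .app R N => by simp only [Atm.ren, Atm.ren_ren ρ τ R, Nrm.ren_ren ρ τ N]
theorem Nrm.ren_ren (ρ τ : ℕ → ℕ) : ∀ N : Nrm, (N.ren τ).ren ρ = N.ren (ρ ∘ τ)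
  | .atom R => by simp only [Nrm.ren, Atm.ren_ren ρ τ R]
  | .lam N => by simp only [Nrm.ren, up_comp, Nrm.ren_ren (up ρ) (up τ) N]
end

theorem ATy.ren_ren (ρ τ : ℕ → ℕ) (P : ATy) : (P.ren τ).ren ρ = P.ren (ρ ∘ τ) := by
  induction P with
  | const a => rfl
  | app P N ih => simp only [ATy.ren, ih, Nrm.ren_ren]

theorem Ty.ren_ren (ρ τ : ℕ → ℕ) (A : Ty) : (A.ren τ).ren ρ = A.ren (ρ ∘ τ) := by
  induction A generalizing ρ τ with
  | atom P => simp only [Ty.ren, ATy.ren_ren]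
  | pi A B ihA ihB => simp only [Ty.ren, ihA, ihB, up_comp]

theorem ASrt.ren_ren (ρ τ : ℕ → ℕ) (Q : ASrt) : (Q.ren τ).ren ρ = Q.ren (ρ ∘ τ) := by
  induction Q with
  | const s => rfl
  | app Q N ih => simp only [ASrt.ren, ih, Nrm.ren_ren]

theorem Srt.ren_ren (ρ τ : ℕ → ℕ) (S : Srt) : (S.ren τ).ren ρ = S.ren (ρ ∘ τ) := by
  induction S generalizing ρ τ with
  | atom Q => simp only [Srt.ren, ASrt.ren_ren]
  | pi S A T ihS ihT => simp only [Srt.ren, ihS, ihT, Ty.ren_ren, up_comp]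
  | top => rfl
  | inter S T ihS ihT => simp only [Srt.ren, ihS, ihT]

theorem ATy.head_ren (ρ : ℕ → ℕ) (P : ATy) : (P.ren ρ).head = P.head := by
  induction P with
  | const a => rfl
  | app P N ih => exact ih

theorem Ty.erase_ren (ρ : ℕ → ℕ) (A : Ty) : (A.ren ρ).erase = A.erase := by
  induction A generalizing ρ with
  | atom P => simp only [Ty.ren, Ty.erase, ATy.head_ren]
  | pi A B ihA ihB => simp only [Ty.ren, Ty.erase, ihA, ihB]

theorem expand_ren (α : STy) (R : Atm) (ρ : ℕ → ℕ) :
    (expand α R).ren ρ = expand α (R.ren ρ) := by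
  induction α generalizing R ρ with
  | base a => rfl
  | arr α β ihα ihβ =>
    simp only [expand, Nrm.ren, ihβ, Atm.ren, ihα, up_zero, Atm.shift_eq_ren, Atm.ren_ren]
    rw [show up ρ ∘ skip 0 = skip 0 ∘ ρ by funext i; simp [skip_zero]]

theorem SubP.head_eq {N₀ k α₀ P P'} (h : SubP N₀ k α₀ P P') : P'.head = P.head := by
  induction h with
  | const => rfl
  | app _ _ ih => exact ih

theorem SubA.erase_eq {N₀ k α₀ A A'} (h : SubA N₀ k α₀ A A') : A'.erase = A.erase := by
  induction h with
  | atom h => simp only [Ty.erase, h.head_eq]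
  | pi _ _ ihA ihB => simp only [Ty.erase, ihA, ihB]

/-! ### Hereditary substitution commutes with renaming -/

/-- The renaming `ρ'` sends the index `k` to `k'` and acts as `ρ` on the other variables. -/
def Compat (k k' : ℕ) (ρ ρ' : ℕ → ℕ) : Prop :=
  ρ' k = k' ∧ ∀ i, ρ' (skip k i) = skip k' (ρ i)

theorem Compat.up {k k' : ℕ} {ρ ρ' : ℕ → ℕ} (h : Compat k k' ρ ρ') :
    Compat (k + 1) (k' + 1) (up ρ) (up ρ') := by
  refine ⟨by simp [h.1], fun i => ?_⟩
  rw [← up_skip, ← up_skip]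
  cases i with
  | zero => rfl
  | succ i => simp [h.2 i]

/-- This is the case of contracting a redex and of dependent application, where the substituted
variable is the innermost one. -/
theorem Compat.zero (ρ : ℕ → ℕ) : Compat 0 0 ρ (LFR.up ρ) := by
  refine ⟨rfl, fun i => ?_⟩
  simp [skip_zero]

/-- This is the case of carrying a substitution under one more binder. -/
theorem Compat.succ (k : ℕ) : Compat k (k + 1) (skip 0) (skip 0) := by
  refine ⟨by simp [skip], fun i => ?_⟩
  simp only [skip]; split_ifs <;> omega

theorem SubRR.skip {N₀ k α₀} (i : ℕ) : SubRR N₀ k α₀ (.var (skip k i)) (.var i) := by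
  unfold LFR.skip
  split_ifs with h
  · exact .varLt h
  · exact .varGt (by omega)

theorem Nrm.shift_zero_ren (N : Nrm) (ρ : ℕ → ℕ) :
    (N.shift 0).ren (up ρ) = (N.ren ρ).shift 0 := by
  simp only [Nrm.shift_eq_ren, Nrm.ren_ren]
  congr 1

mutual
theorem SubN.ren {N₀ k α₀ N N'} : SubN N₀ k α₀ N N' → ∀ {k' ρ ρ'}, Compat k k' ρ ρ' →
    SubN (N₀.ren ρ) k' α₀ (N.ren ρ') (N'.ren ρ)
  | .atom h, _, _, _, hc => .atom (h.ren hc)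
  | .atomNorm h, _, _, _, hc => .atomNorm (h.ren hc)
  | .lam h, _, _, _, hc => .lam (by have := h.ren hc.up; rwa [Nrm.shift_zero_ren] at this)
theorem SubRR.ren {N₀ k α₀ R R'} : SubRR N₀ k α₀ R R' → ∀ {k' ρ ρ'}, Compat k k' ρ ρ' →
    SubRR (N₀.ren ρ) k' α₀ (R.ren ρ') (R'.ren ρ)
  | .varLt (i := i) h, k', ρ, ρ', hc => by
    have := hc.2 i
    rw [LFR.skip, if_pos h] at this
    simp only [Atm.ren, this]
    exact .skip _
  | .varGt (i := i) h, k', ρ, ρ', hc => by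
    have := hc.2 i
    rw [LFR.skip, if_neg (by omega)] at this
    simp only [Atm.ren, this]
    exact .skip _
  | .const, _, _, _, _ => .const
  | .app h₁ h₂, _, _, _, hc => .app (h₁.ren hc) (h₂.ren hc)
theorem SubRN.ren {N₀ k α₀ R N' α} : SubRN N₀ k α₀ R N' α → ∀ {k' ρ ρ'}, Compat k k' ρ ρ' →
    SubRN (N₀.ren ρ) k' α₀ (R.ren ρ') (N'.ren ρ) α
  | .var, _, _, _, hc => by
    simp only [Atm.ren, hc.1]
    exact .var
  | .beta h₁ h₂ h₃, _, ρ, _, hc =>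
    .beta (h₁.ren hc) (h₂.ren hc) (h₃.ren (Compat.zero ρ))
end

theorem SubP.ren {N₀ k α₀ P P'} (h : SubP N₀ k α₀ P P') {k' ρ ρ'} (hc : Compat k k' ρ ρ') :
    SubP (N₀.ren ρ) k' α₀ (P.ren ρ') (P'.ren ρ) := by
  induction h with
  | const => exact .const
  | app _ hN ih => exact .app ih (hN.ren hc)

theorem SubA.ren {N₀ k α₀ A A'} (h : SubA N₀ k α₀ A A') {k' ρ ρ'} (hc : Compat k k' ρ ρ') :
    SubA (N₀.ren ρ) k' α₀ (A.ren ρ') (A'.ren ρ) := by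
  induction h generalizing k' ρ ρ' with
  | atom h => exact .atom (h.ren hc)
  | pi _ _ ihA ihB => exact .pi (ihA hc) (by have := ihB hc.up; rwa [Nrm.shift_zero_ren] at this)

theorem SubQ.ren {N₀ k α₀ Q Q'} (h : SubQ N₀ k α₀ Q Q') {k' ρ ρ'} (hc : Compat k k' ρ ρ') :
    SubQ (N₀.ren ρ) k' α₀ (Q.ren ρ') (Q'.ren ρ) := by
  induction h with
  | const => exact .const
  | app _ hN ih => exact .app ih (hN.ren hc)

theorem SubS.ren {N₀ k α₀ S S'} (h : SubS N₀ k α₀ S S') {k' ρ ρ'} (hc : Compat k k' ρ ρ') :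
    SubS (N₀.ren ρ) k' α₀ (S.ren ρ') (S'.ren ρ) := by
  induction h generalizing k' ρ ρ' with
  | atom h => exact .atom (h.ren hc)
  | pi _ hA _ ihS ihT =>
    exact .pi (ihS hc) (hA.ren hc) (by have := ihT hc.up; rwa [Nrm.shift_zero_ren] at this)
  | top => exact .top
  | inter _ _ ihS ihT => exact .inter (ihS hc) (ihT hc)

mutual
/-- Substitution for a variable that does not occur undoes weakening. -/
theorem SubRR.of_skip (α₀ : STy) : ∀ (R : Atm) (N₀ : Nrm) (k : ℕ),
    SubRR N₀ k α₀ (R.ren (LFR.skip k)) R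
  | .const _, _, _ => .const
  | .var i, _, _ => .skip i
  | .app R N, N₀, k => .app (SubRR.of_skip α₀ R N₀ k) (SubN.of_skip α₀ N N₀ k)
theorem SubN.of_skip (α₀ : STy) : ∀ (N : Nrm) (N₀ : Nrm) (k : ℕ),
    SubN N₀ k α₀ (N.ren (LFR.skip k)) N
  | .atom R, N₀, k => .atom (SubRR.of_skip α₀ R N₀ k)
  | .lam N, N₀, k => .lam (by rw [up_skip]; exact SubN.of_skip α₀ N _ (k + 1))
end

/-! ### Simple typing

Constants are unconstrained: only the applications of variables matter for η-expansion. -/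

mutual
/-- `Δ ⊢ R : α`. -/
inductive RTy : List STy → Atm → STy → Prop
  | const {Δ c α} : RTy Δ (.const c) α
  | var {Δ : List STy} {i : ℕ} {α} : Δ[i]? = some α → RTy Δ (.var i) α
  | app {Δ R N α β} : RTy Δ R (.arr α β) → NTy Δ N α → RTy Δ (.app R N) β
/-- `Δ ⊢ N : α`, with `N` η-long. -/
inductive NTy : List STy → Nrm → STy → Prop
  | atom {Δ R a} : RTy Δ R (.base a) → NTy Δ (.atom R) (.base a)
  | lam {Δ N α β} : NTy (α :: Δ) N β → NTy Δ (.lam N) (.arr α β)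
end

/-- The arguments of an atomic type are simply typed. -/
inductive ATyTyped : List STy → ATy → Prop
  | const {Δ a} : ATyTyped Δ (.const a)
  | app {Δ P N α} : ATyTyped Δ P → NTy Δ N α → ATyTyped Δ (.app P N)

/-- The index terms of a type are simply typed. -/
inductive TyTyped : List STy → Ty → Prop
  | atom {Δ P} : ATyTyped Δ P → TyTyped Δ (.atom P)
  | pi {Δ A B} : TyTyped Δ A → TyTyped (A.erase :: Δ) B → TyTyped Δ (.pi A B)

/-- The arguments of an atomic sort are simply typed. -/
inductive ASrtTyped : List STy → ASrt → Prop
  | const {Δ s} : ASrtTyped Δ (.const s)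
  | app {Δ Q N α} : ASrtTyped Δ Q → NTy Δ N α → ASrtTyped Δ (.app Q N)

/-- The sort refines the simple type, and its index terms are simply typed. -/
inductive SrtTyped : List STy → Srt → STy → Prop
  | atom {Δ Q a} : ASrtTyped Δ Q → SrtTyped Δ (.atom Q) (.base a)
  | pi {Δ S A T β} : SrtTyped Δ S A.erase → TyTyped Δ A → SrtTyped (A.erase :: Δ) T β →
      SrtTyped Δ (.pi S A T) (.arr A.erase β)
  | top {Δ α} : SrtTyped Δ .top α
  | inter {Δ S T α} : SrtTyped Δ S α → SrtTyped Δ T α → SrtTyped Δ (.inter S T) α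

theorem LFLookup.erase {Γ i A} (h : LFLookup Γ i A) : (Γ.map Ty.erase)[i]? = some A.erase := by
  induction h with
  | here => simp [Ty.shift_eq_ren, Ty.erase_ren]
  | there _ ih => simpa [Ty.shift_eq_ren, Ty.erase_ren] using ih

mutual
-- Canonical terms are η-long because LF checks an atomic term only at an atomic type.
theorem LFSynth.simplyTyped {Sg Γ R A} :
    LFSynth Sg Γ R A → RTy (Γ.map Ty.erase) R A.erase
  | .const _ => .const
  | .var h => .var h.erase
  -- Substitution into the dependent codomain leaves its erasure unchanged.
  | .app hR hN hB => hB.erase_eq ▸ .app hR.simplyTyped hN.simplyTyped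
theorem LFCheck.simplyTyped {Sg Γ N A} :
    LFCheck Sg Γ N A → NTy (Γ.map Ty.erase) N A.erase
  | .atom h => .atom h.simplyTyped
  | .lam h => .lam h.simplyTyped
end

theorem LFSynthKind.typed {Sg Γ P K} (h : LFSynthKind Sg Γ P K) :
    ATyTyped (Γ.map Ty.erase) P := by
  induction h with
  | const _ => exact .const
  | app _ hN _ ih => exact .app ih hN.simplyTyped

theorem LFType.typed {Sg Γ A} (h : LFType Sg Γ A) : TyTyped (Γ.map Ty.erase) A := by
  induction h with
  | atom h => exact .atom h.typed
  | pi _ _ ihA ihB => exact .pi ihA ihB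

/-- The arguments of `Q` are literally those of `P`, so their typing comes from the LF side and the
sort-checking premises play no role. -/
theorem SynthClass.typed {Sg Γ Q P L Δ} (h : SynthClass Sg Γ Q P L) (hP : ATyTyped Δ P) :
    ASrtTyped Δ Q := by
  induction h with
  | const _ => exact .const
  | app _ _ _ ih =>
    cases hP with
    | app hP hN => exact .app (ih hP) hN
  | interE₁ _ ih => exact ih hP
  | interE₂ _ ih => exact ih hP

/-- A sort that refines a type with simply typed index terms is itself simply typed. -/
theorem Refines.typed {Sg Γ S A Δ} (h : Refines Sg Γ S A) (hA : TyTyped Δ A) :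
    SrtTyped Δ S A.erase := by
  induction h generalizing Δ with
  | atom h =>
    cases hA with
    | atom hP => exact .atom (h.typed hP)
  | pi _ _ ihS ihT =>
    cases hA with
    | pi hA hB => exact .pi (ihS hA) hA (ihT hB)
  | top => exact .top
  | inter _ _ ihS ihT => exact .inter (ihS hA) (ihT hA)

/-! Renamings that fix the declared variables act trivially; in particular on closed sorts. -/

theorem up_fixes {n : ℕ} {ρ : ℕ → ℕ} (h : ∀ i < n, ρ i = i) : ∀ i < n + 1, up ρ i = i
  | 0, _ => rfl
  | i + 1, hi => by simp [h i (by omega)]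

mutual
theorem RTy.ren_eq {Δ R α} : RTy Δ R α → ∀ {ρ}, (∀ i < Δ.length, ρ i = i) → R.ren ρ = R
  | .const, _, _ => rfl
  | .var h, _, hρ => by rw [Atm.ren, hρ _ (List.getElem?_eq_some_iff.1 h).1]
  | .app hR hN, _, hρ => by rw [Atm.ren, hR.ren_eq hρ, hN.ren_eq hρ]
theorem NTy.ren_eq {Δ N α} : NTy Δ N α → ∀ {ρ}, (∀ i < Δ.length, ρ i = i) → N.ren ρ = N
  | .atom h, _, hρ => by rw [Nrm.ren, h.ren_eq hρ]
  | .lam h, _, hρ => by rw [Nrm.ren, h.ren_eq (up_fixes hρ)]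
end

theorem ATyTyped.ren_eq {Δ P} (h : ATyTyped Δ P) {ρ : ℕ → ℕ} (hρ : ∀ i < Δ.length, ρ i = i) :
    P.ren ρ = P := by
  induction h with
  | const => rfl
  | app _ hN ih => rw [ATy.ren, ih, hN.ren_eq hρ]

theorem TyTyped.ren_eq {Δ A} (h : TyTyped Δ A) {ρ : ℕ → ℕ} (hρ : ∀ i < Δ.length, ρ i = i) :
    A.ren ρ = A := by
  induction h generalizing ρ with
  | atom h => rw [Ty.ren, h.ren_eq hρ]
  | pi _ _ ihA ihB => rw [Ty.ren, ihA hρ, ihB (up_fixes hρ)]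

theorem ASrtTyped.ren_eq {Δ Q} (h : ASrtTyped Δ Q) {ρ : ℕ → ℕ}
    (hρ : ∀ i < Δ.length, ρ i = i) : Q.ren ρ = Q := by
  induction h with
  | const => rfl
  | app _ hN ih => rw [ASrt.ren, ih, hN.ren_eq hρ]

theorem SrtTyped.ren_eq {Δ S α} (h : SrtTyped Δ S α) {ρ : ℕ → ℕ}
    (hρ : ∀ i < Δ.length, ρ i = i) : S.ren ρ = S := by
  induction h generalizing ρ with
  | atom h => rw [Srt.ren, h.ren_eq hρ]
  | pi _ hA _ ihS ihT => rw [Srt.ren, ihS hρ, hA.ren_eq hρ, ihT (up_fixes hρ)]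
  | top => rfl
  | inter _ _ ihS ihT => rw [Srt.ren, ihS hρ, ihT hρ]

/-! ### Substituting an η-expanded variable is renaming -/

/-- The renaming that replaces the index `k` by `y` and removes it. -/
def contract (k y i : ℕ) : ℕ := if i < k then i else if i = k then y else i - 1

theorem up_contract (k y : ℕ) : up (contract k y) = contract (k + 1) (y + 1) := by
  funext i
  cases i with
  | zero => simp [contract]
  | succ i => simp only [up_succ, contract]; split_ifs <;> omega

theorem contract_zero_comp_up (y : ℕ) (ρ : ℕ → ℕ) : contract 0 y ∘ up ρ = scons y ρ := by
  funext i; cases i <;> simp [contract, scons]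

/-- If substitution takes an atomic term with another head to an atomic term, it commutes with
η-expansion. -/
theorem SubRR.expand {N₀ k α₀ R R'} (β : STy) (h : SubRR N₀ k α₀ R R') :
    SubN N₀ k α₀ (expand β R) (expand β R') := by
  induction β generalizing N₀ k R R' with
  | base a => exact .atom h
  | arr α β ihα ihβ =>
    -- Under the binder the substituted index is `k + 1`. The bound variable `0` lies below it, so
    -- its expansion is left unchanged.
    refine .lam (ihβ (.app ?_ (ihα (.varLt (Nat.succ_pos k)))))
    simp only [Atm.shift_eq_ren, Nrm.shift_eq_ren]
    exact h.ren (Compat.succ k)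

/-- If substitution takes an atomic term to a simply typed normal term at the simple type `β`,
it takes the η-expansion of that atomic term at `β` to the same normal term. -/
def Absorbs (β : STy) : Prop :=
  ∀ {Δ M}, NTy Δ M β → ∀ {N₀ k α₀ R} (τ : ℕ → ℕ), SubRN N₀ k α₀ R (M.ren τ) β →
    SubN N₀ k α₀ (expand β R) (M.ren τ)

/-- All argument types of a simple type satisfy `Absorbs`. -/
def ArgsAbsorb : STy → Prop
  | .base _ => True
  | .arr α β => Absorbs α ∧ ArgsAbsorb β

/-- Only variables of simple type `α` are sent to the index `k`. -/
def HitsAt (Δ : List STy) (ρ : ℕ → ℕ) (k : ℕ) (α : STy) : Prop :=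
  ∀ i β, Δ[i]? = some β → ρ i = k → β = α

theorem HitsAt.up {Δ ρ k α} (h : HitsAt Δ ρ k α) (γ : STy) :
    HitsAt (γ :: Δ) (up ρ) (k + 1) α
  | 0, _, _, hi => by simp at hi
  | i + 1, β, hβ, hi => h i β (by simpa using hβ) (by simpa using hi)

theorem HitsAt.zero (Δ : List STy) (ρ : ℕ → ℕ) (α : STy) : HitsAt (α :: Δ) (LFR.up ρ) 0 α
  | 0, _, hβ, _ => by simpa using hβ.symm
  | i + 1, _, _, hi => by simp at hi

/-- Contracting an η-expansion against an argument: the weakened head is restored, and the expanded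
bound variable becomes the argument itself, which is `Absorbs` applied to a bare variable. -/
theorem SubN.of_absorbs {α β : STy} (hα : Absorbs α) {Δ N} (hN : NTy Δ N α) (τ : ℕ → ℕ)
    (R : Atm) :
    SubN (N.ren τ) 0 α (expand β (.app (R.shift 0) (expand α (.var 0))))
      (expand β (.app R (N.ren τ))) := by
  refine SubRR.expand β (.app ?_ (hα hN τ .var))
  rw [Atm.shift_eq_ren]
  exact SubRR.of_skip α R _ 0

mutual
-- `HitsAt` is all that is asked of `ρ`, so typing need not be transported along renamings. When the
-- head is the substituted variable, each argument strips one arrow from `α`, and `ArgsAbsorb`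
-- passes to the codomain that remains.
theorem RTy.sub_expand {α : STy} (hα : ArgsAbsorb α) {Δ R β} : RTy Δ R β →
    ∀ {ρ k}, HitsAt Δ ρ k α → ∀ y,
    SubRR (expand α (.var y)) k α (R.ren ρ) ((R.ren ρ).ren (contract k y)) ∨
    (SubRN (expand α (.var y)) k α (R.ren ρ) (expand β ((R.ren ρ).ren (contract k y))) β ∧
      ArgsAbsorb β)
  | .const, _, _, _, _ => .inl .const
  | .var (i := i) (α := β) h, ρ, k, hρ, y => by
    simp only [Atm.ren]
    rcases lt_trichotomy (ρ i) k with hi | hi | hi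
    · left
      rw [contract, if_pos hi]
      exact .varLt hi
    · right
      obtain rfl := hρ i β h hi
      rw [hi, contract, if_neg (lt_irrefl k), if_pos rfl]
      exact ⟨.var, hα⟩
    · left
      rw [contract, if_neg (by omega), if_neg (by omega)]
      obtain ⟨j, hj⟩ : ∃ j, ρ i = j + 1 := ⟨ρ i - 1, by omega⟩
      rw [hj]
      exact .varGt (by omega)
  | .app hR hN, ρ, k, hρ, y => by
    have h₂ := hN.sub_expand hα hρ y
    rcases hR.sub_expand hα hρ y with h₁ | ⟨h₁, ha, hb⟩
    · exact .inl (.app h₁ h₂)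
    -- Expansion at an arrow type is by definition a λ, so `h₁` supplies the redex.
    · refine .inr ⟨.beta h₁ h₂ ?_, hb⟩
      simp only [Atm.ren]
      rw [Nrm.ren_ren]
      exact SubN.of_absorbs ha hN _ _
theorem NTy.sub_expand {α : STy} (hα : ArgsAbsorb α) {Δ N β} : NTy Δ N β →
    ∀ {ρ k}, HitsAt Δ ρ k α → ∀ y,
    SubN (expand α (.var y)) k α (N.ren ρ) ((N.ren ρ).ren (contract k y))
  | .atom h, _, _, hρ, y => by
    rcases h.sub_expand hα hρ y with h₁ | ⟨h₁, -⟩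
    · exact .atom h₁
    · exact .atomNorm h₁
  | .lam h, ρ, k, hρ, y => by
    refine .lam ?_
    rw [up_contract, Nrm.shift_eq_ren, expand_ren]
    simpa [Atm.ren, skip_zero] using h.sub_expand hα (hρ.up _) (y + 1)
end

/-- The two claims feed each other: `Absorbs` at `α → β` needs `ArgsAbsorb` at `α`, to substitute an
expanded variable into the body, and `Absorbs` at `β` for the body itself. -/
theorem absorbs_and_argsAbsorb (β : STy) : Absorbs β ∧ ArgsAbsorb β := by
  induction β with
  | base a =>
    refine ⟨?_, trivial⟩
    intro Δ M hM N₀ k α₀ R τ h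
    cases hM
    exact .atomNorm h
  | arr α β ihα ihβ =>
    refine ⟨?_, ihα.1, ihβ.2⟩
    intro Δ M hM N₀ k α₀ R τ h
    cases hM with
    | @lam _ M _ _ hM =>
      refine .lam (ihβ.1 hM (up τ) ?_)
      have h₁ := h.ren (Compat.succ k)
      -- The weakened `R` reduces to a λ whose body is renamed by `up (skip 0 ∘ τ)`. Feeding it the
      -- expanded variable `0` contracts this renaming back to `up τ`.
      have h₂ := hM.sub_expand ihα.2 (HitsAt.zero _ (skip 0 ∘ τ) α) 0
      rw [Nrm.ren_ren, contract_zero_comp_up] at h₂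
      rw [Nrm.ren_ren, Nrm.ren, ← Atm.shift_eq_ren, ← Nrm.shift_eq_ren] at h₁
      exact .beta h₁ (SubRR.expand α (.varLt (Nat.succ_pos k))) (scons_zero_skip τ ▸ h₂)

theorem ASrtTyped.sub_expand {Δ Q} (h : ASrtTyped Δ Q) {ρ k α} (hρ : HitsAt Δ ρ k α) (y : ℕ) :
    SubQ (expand α (.var y)) k α (Q.ren ρ) ((Q.ren ρ).ren (contract k y)) := by
  induction h with
  | const => exact .const
  | app _ hN ih => exact .app ih (hN.sub_expand (absorbs_and_argsAbsorb α).2 hρ y)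

theorem ATyTyped.sub_expand {Δ P} (h : ATyTyped Δ P) {ρ k α} (hρ : HitsAt Δ ρ k α) (y : ℕ) :
    SubP (expand α (.var y)) k α (P.ren ρ) ((P.ren ρ).ren (contract k y)) := by
  induction h with
  | const => exact .const
  | app _ hN ih => exact .app ih (hN.sub_expand (absorbs_and_argsAbsorb α).2 hρ y)

theorem expand_var_shift (α : STy) (y : ℕ) :
    (expand α (.var y)).shift 0 = expand α (.var (y + 1)) := by
  rw [Nrm.shift_eq_ren, expand_ren, Atm.ren, skip_zero]

theorem TyTyped.sub_expand {Δ A} (h : TyTyped Δ A) {ρ k α} (hρ : HitsAt Δ ρ k α) (y : ℕ) :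
    SubA (expand α (.var y)) k α (A.ren ρ) ((A.ren ρ).ren (contract k y)) := by
  induction h generalizing ρ k y with
  | atom h => exact .atom (h.sub_expand hρ y)
  | pi _ _ ihA ihB =>
    refine .pi (ihA hρ y) ?_
    rw [up_contract, expand_var_shift]
    exact ihB (hρ.up _) (y + 1)

theorem SrtTyped.sub_expand {Δ S β} (h : SrtTyped Δ S β) {ρ k α} (hρ : HitsAt Δ ρ k α)
    (y : ℕ) : SubS (expand α (.var y)) k α (S.ren ρ) ((S.ren ρ).ren (contract k y)) := by
  induction h generalizing ρ k y with
  | atom h => exact .atom (h.sub_expand hρ y)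
  | pi _ hA _ ihS ihT =>
    refine .pi (ihS hρ y) (hA.sub_expand hρ y) ?_
    rw [up_contract, expand_var_shift]
    exact ihT (hρ.up _) (y + 1)
  | top => exact .top
  | inter _ _ ihS ihT => exact .inter (ihS hρ y) (ihT hρ y)

/-! ### Weakening of sort checking -/

/-- The constants of the signature have closed sorts. -/
def ClosedRefs (Sg : Sig) : Prop :=
  ∀ c S, Decl.tmRef c S ∈ Sg → ∀ ρ, S.ren ρ = S

theorem SigWf.tmDecl_typed {Sg c A} (h : SigWf Sg) (hc : Decl.tmDecl c A ∈ Sg) :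
    TyTyped [] A := by
  induction h with
  | nil => simp at hc
  | tmDecl _ hA _ ih =>
    rcases List.mem_cons.1 hc with h | h
    · cases h; exact hA.typed
    · exact ih h
  | _ => simp_all

/-- The sort of a constant refines a closed LF type, so its index terms are typed in the empty
context. Weakening needs this because constants synthesize their declared sorts unshifted. -/
theorem SigWf.closedRefs {Sg} (h : SigWf Sg) : ClosedRefs Sg := by
  intro c S hc ρ
  induction h with
  | nil => simp at hc
  | tmRef hSg hA hS _ ih =>
    rcases List.mem_cons.1 hc with h | h
    · cases h
      exact (hS.typed (hSg.tmDecl_typed hA)).ren_eq (by simp)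
    · exact ih h
  | _ => simp_all

/-- The renaming `ξ` takes declarations of `Γ` to declarations of `Γ'`. -/
def CtxRen (Γ : Ctx) (ξ : ℕ → ℕ) (Γ' : Ctx) : Prop :=
  ∀ i S A, Lookup Γ i S A → Lookup Γ' (ξ i) (S.ren ξ) (A.ren ξ)

theorem CtxRen.weaken (Γ : Ctx) (e : Srt × Ty) : CtxRen Γ (skip 0) (e :: Γ) := by
  intro i S A h
  rw [← Srt.shift_eq_ren, ← Ty.shift_eq_ren, skip_zero]
  exact .there h

theorem CtxRen.up {Γ ξ Γ'} (h : CtxRen Γ ξ Γ') (S : Srt) (A : Ty) :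
    CtxRen ((S, A) :: Γ) (up ξ) ((S.ren ξ, A.ren ξ) :: Γ') := by
  have hs : LFR.up ξ ∘ skip 0 = skip 0 ∘ ξ := by funext i; simp [skip_zero]
  intro i S' A' hl
  cases hl with
  | here =>
    rw [Srt.shift_eq_ren, Ty.shift_eq_ren, Srt.ren_ren, Ty.ren_ren, hs, ← Srt.ren_ren,
      ← Ty.ren_ren, ← Srt.shift_eq_ren, ← Ty.shift_eq_ren]
    exact .here
  | there hl =>
    rw [Srt.shift_eq_ren, Ty.shift_eq_ren, Srt.ren_ren, Ty.ren_ren, hs, ← Srt.ren_ren,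
      ← Ty.ren_ren, ← Srt.shift_eq_ren, ← Ty.shift_eq_ren]
    exact .there (h _ _ _ hl)

theorem SubStep.ren {Sg Q₁ Q₂} (h : SubStep Sg Q₁ Q₂) (ρ : ℕ → ℕ) :
    SubStep Sg (Q₁.ren ρ) (Q₂.ren ρ) := by
  induction h with
  | decl h => exact .decl h
  | app _ ih => exact .app ih

theorem AtomSub.ren {Sg Q₁ Q₂} (h : AtomSub Sg Q₁ Q₂) (ρ : ℕ → ℕ) :
    AtomSub Sg (Q₁.ren ρ) (Q₂.ren ρ) := by
  induction h with
  | refl => exact .refl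
  | step h _ ih => exact .step (h.ren ρ) ih

theorem AtomSub.trans {Sg Q₁ Q₂ Q₃} (h : AtomSub Sg Q₁ Q₂) (h' : AtomSub Sg Q₂ Q₃) :
    AtomSub Sg Q₁ Q₃ := by
  induction h with
  | refl => exact h'
  | step h _ ih => exact .step h (ih h')

mutual
-- Arbitrary declaration-preserving renamings are allowed because the Π clause of `Sem` quantifies
-- over all of them.
theorem Synth.ren {Sg} (hSg : ClosedRefs Sg) {Γ R S} : Synth Sg Γ R S →
    ∀ {ξ Γ'}, CtxRen Γ ξ Γ' → Synth Sg Γ' (R.ren ξ) (S.ren ξ)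
  | .const h, ξ, _, _ => by
    rw [hSg _ _ h ξ]
    exact .const h
  | .var h, _, _, hξ => .var (hξ _ _ _ h)
  | .app (A := A) hR hN hT, ξ, _, hξ => by
    refine .app (hR.ren hSg hξ) (hN.ren hSg hξ) ?_
    rw [Ty.erase_ren]
    exact hT.ren (Compat.zero ξ)
  | .interE₁ h, _, _, hξ => .interE₁ (h.ren hSg hξ)
  | .interE₂ h, _, _, hξ => .interE₂ (h.ren hSg hξ)
theorem Check.ren {Sg} (hSg : ClosedRefs Sg) {Γ N S} : Check Sg Γ N S →
    ∀ {ξ Γ'}, CtxRen Γ ξ Γ' → Check Sg Γ' (N.ren ξ) (S.ren ξ)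
  | .switch h hQ, ξ, _, hξ => .switch (h.ren hSg hξ) (hQ.ren ξ)
  | .lam h, _, _, hξ => .lam (h.ren hSg (hξ.up _ _))
  | .top, _, _, _ => .top
  | .inter h₁ h₂, _, _, hξ => .inter (h₁.ren hSg hξ) (h₂.ren hSg hξ)
end

/-! ### A Kripke semantics of sorts -/

/-- `Sem Sg S ρ Γ R`: in the context `Γ`, the atomic term `R` behaves like an inhabitant of the
sort `S`, renamed by `ρ`, when it is applied to η-expanded variables. -/
def Sem (Sg : Sig) : Srt → (ℕ → ℕ) → Ctx → Atm → Prop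
  | .atom Q, ρ, Γ, R => ∃ Q₀, Synth Sg Γ R (.atom Q₀) ∧ AtomSub Sg Q₀ (Q.ren ρ)
  | .pi S A T, ρ, Γ, R => ∀ Γ' ξ, CtxRen Γ ξ Γ' → ∀ y, Sem Sg S (ξ ∘ ρ) Γ' (.var y) →
      Sem Sg T (scons y (ξ ∘ ρ)) Γ' (.app (R.ren ξ) (expand A.erase (.var y)))
  | .top, _, _, _ => True
  | .inter S T, ρ, Γ, R => Sem Sg S ρ Γ R ∧ Sem Sg T ρ Γ R

/-- Declarative subsorting is inclusion in the semantics, for arbitrary raw sorts. -/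
theorem DeclSub.sem {Sg Γ₀ S T A} (h : DeclSub Sg Γ₀ S T A) {ρ Γ R} (hR : Sem Sg S ρ Γ R) :
    Sem Sg T ρ Γ R := by
  induction h generalizing ρ Γ R with
  | atom h =>
    obtain ⟨Q₀, h₁, h₂⟩ := hR
    exact ⟨Q₀, h₁, h₂.trans (h.ren ρ)⟩
  | refl => exact hR
  | trans _ _ ih₁ ih₂ => exact ih₂ (ih₁ hR)
  -- A test variable for the smaller domain is one for the larger domain. Both sorts carry the same
  -- `A`, so the expanded argument is the same.
  | pi _ _ ihS ihT => exact fun Γ' ξ hξ y hy => ihT (hR Γ' ξ hξ y (ihS hy))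
  | topR => trivial
  | interR _ _ ih₁ ih₂ => exact ⟨ih₁ hR, ih₂ hR⟩
  | interL₁ _ ih => exact ih hR.1
  | interL₂ _ ih => exact ih hR.2
  -- The Π clause is a universal statement, so it commutes with truth and conjunction.
  | topPi => exact fun _ _ _ _ _ => trivial
  | interPi => exact fun Γ' ξ hξ y hy => ⟨hR.1 Γ' ξ hξ y hy, hR.2 Γ' ξ hξ y hy⟩

/-- For simply typed sorts, synthesis implies the semantics, and the semantics implies that the
η-expansion checks. -/
theorem SrtTyped.reflect_reify {Sg} (hSg : ClosedRefs Sg) {Δ S α} (h : SrtTyped Δ S α) :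
    (∀ {ρ Γ R}, Synth Sg Γ R (S.ren ρ) → Sem Sg S ρ Γ R) ∧
    (∀ {ρ Γ R}, Sem Sg S ρ Γ R → Check Sg Γ (expand α R) (S.ren ρ)) := by
  induction h with
  | atom _ => exact ⟨fun h => ⟨_, h, .refl⟩, fun ⟨_, h₁, h₂⟩ => .switch h₁ h₂⟩
  | @pi Δ S A T β hS _ hT ihS ihT =>
    constructor
    · intro ρ Γ R hR Γ' ξ hξ y hy
      refine ihT.1 ?_
      have hR' := hR.ren hSg hξ
      rw [Srt.ren_ren] at hR'
      -- Reification at the domain makes the expanded `y` a legal argument; what remains is that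
      -- substituting it into `T` is the renaming `contract 0 y`.
      refine .app hR' (ihS.2 hy) ?_
      rw [Ty.erase_ren, ← contract_zero_comp_up, ← Srt.ren_ren]
      exact hT.sub_expand (HitsAt.zero _ _ _) y
    · intro ρ Γ R hR
      refine .lam ?_
      -- In the context extended by the bound variable, reflection at the domain makes that variable
      -- a valid test argument.
      have hx : Sem Sg S (skip 0 ∘ ρ) ((S.ren ρ, A.ren ρ) :: Γ) (.var 0) := by
        refine ihS.1 ?_
        rw [← Srt.ren_ren, ← Srt.shift_eq_ren]
        exact .var .here
      have := ihT.2 (hR _ _ (CtxRen.weaken Γ _) 0 hx)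
      rwa [← Atm.shift_eq_ren, scons_zero_skip] at this
  | top => exact ⟨fun _ => trivial, fun _ => .top⟩
  | inter _ _ ihS ihT =>
    exact ⟨fun h => ⟨ihS.1 (.interE₁ h), ihT.1 (.interE₂ h)⟩,
      fun h => .inter (ihS.2 h.1) (ihT.2 h.2)⟩

end LFR

/-- Soundness of declarative subsorting: if `Γ ⊢ S ≤ T ⊏ A`, then `Γ, x::S⊏A ⊢ η_A(x) ⇐ T`.
The hypotheses before the last say that the subjects of the judgments are well-formed. -/
theorem mainTheorem5 (Sg : LFR.Sig) (Γ : LFR.Ctx) (S T : LFR.Srt) (A : LFR.Ty)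
    (hSg : LFR.SigWf Sg)
    (hΓ : LFR.CtxWf Sg Γ) (hΓLF : LFR.LFCtxWf (LFR.Sig.erase Sg) (LFR.Ctx.erase Γ))
    (hA : LFR.LFType (LFR.Sig.erase Sg) (LFR.Ctx.erase Γ) A)
    (hS : LFR.Refines Sg Γ S A) (hT : LFR.Refines Sg Γ T A)
    (hST : LFR.DeclSub Sg Γ S T A) :
    LFR.Check Sg ((S, A) :: Γ) (LFR.expand A.erase (.var 0)) (T.shift 0) := by
  have hc := hSg.closedRefs
  have hA' := hA.typed
  rw [LFR.Srt.shift_eq_ren]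
  -- Both sorts are read with the renaming `skip 0`, since they come from `Γ` and are used in its
  -- extension by `x`.
  refine ((hT.typed hA').reflect_reify hc).2 (hST.sem (((hS.typed hA').reflect_reify hc).1 ?_))
  rw [← LFR.Srt.shift_eq_ren]
  exact .var .here
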